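/- Let $K$ be a field with prime subfield $\Omega$, let $n\ge 1$, and let $x,z,y_1,\dots,y_n$ be indeterminates over $K$. For an extension of domains $A\subseteq B$, the generic fiber is the set of prime ideals $Q$ of $B$ with $Q\cap A=0$, and its dimension is the supremum of the lengths of chains of such primes. For domains $R\subseteq T$, elements $\lambda_1,\dots,\lambda_n\in zT[[z]]$ are called analytically independent over $R[[z]]$ if the $R[[z]]$-algebra morphism $R[[z]][[y_1,\dots,y_n]]\to T[[z]]$ with $y_i\mapsto\lambda_i$ is injective. Write $K[x,y_1,\dots,y_n]_x=K[x,y_1,\dots,y_n][1/x]$. (1) The generic fiber of the extension $K[x,y_1,\dots,y_n][[z]]\hookrightarrow K[x,y_1,\dots,y_n]_x[[z]]$ has dimension $\ge n$. (2) Let $\sigma_1,\dots,\sigma_n\in zK[[z]]$ be algebraically independent over $K(z)$, and put $\lambda_j=x\,\sigma_j(z/x)$, that is, $\lambda_j=\sum_{m\ge1}s_{j,m}x^{1-m}z^m$ if $\sigma_j=\sum_{m\ge1}s_{j,m}z^m$. Then $\lambda_1,\dots,\lambda_n$ are analytically independent over $K[[x]][[z]]=K[[x,z]]$ (with $R=K[[x]]$,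 $T=K((x))$). For $0\le j\le n$ let $P_j$ be the kernel of the $K((x))[[z]]$-algebra morphism $$\theta_j:K((x))[[z,y_1,\dots,y_n]]\to K((x))[[z,y_{j+1},\dots,y_n]],\qquad \theta_j(y_i)=\lambda_i\ (i\le j),\quad \theta_j(y_i)=y_i\ (i>j),$$ and let $Q_j=P_j\cap K[x,y_1,\dots,y_n]_x[[z]]$. Then $P_0=0$; each $P_j$ is the prime ideal generated by $y_1-\lambda_1,\dots,y_j-\lambda_j$; $y_j-\lambda_j\in P_j\setminus P_{j-1}$ for $1\le j\le n$; and $P_n\cap K[[x,z,y_1,\dots,y_n]]=0$. Moreover $$0=Q_0\subsetneq Q_1\subsetneq\dots\subsetneq Q_n$$ is a chain of prime ideals of $K[x,y_1,\dots,y_n]_x[[z]]$, with $y_j-\lambda_j\in Q_j\setminus Q_{j-1}$ for $1\le j\le n$, and $Q_j\cap K[x,y_1,\dots,y_n][[z]]=0$ for $0\le j\le n$, so that every $Q_j$ lies in the generic fiber. (3) If $\sigma_1,\dots,\sigma_n\in z\Omega[[z]]$ are algebraically independent over $\Omega(z)$, then they are algebraically independent over $K(z)$. Such elements exist; thus the $\sigma_j$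 in (2) can be chosen in $z\Omega[[z]]$. -/

import Mathlib

open scoped PowerSeries LaurentSeries

noncomputable section

namespace GenericFiber

/-- The generic fiber of a ring homomorphism `f : A → B`: the prime ideals of `B` lying over zero
in `A`, ordered by inclusion. -/
def genericFiber {A B : Type*} [CommRing A] [CommRing B] (f : A →+* B) : Set (PrimeSpectrum B) :=
  {Q | Q.asIdeal.comap f = ⊥}

/-- The dimension of the generic fiber: the supremum of the lengths of its chains of primes. -/
def genericFiberDim {A B : Type*} [CommRing A] [CommRing B] (f : A →+* B) : WithBot ℕ∞ :=
  Order.krullDim (genericFiber f)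

/-- `x σ(z/x) ∈ T[[z]]`, for a `K`-algebra `T`, a unit `x` of `T` and `σ ∈ K[[z]]`; if
`σ = ∑ s_m z ^ m`, this is the series `∑ s_m x ^ (1 - m) z ^ m`. -/
def twist {K T : Type*} [CommRing K] [CommRing T] [Algebra K T] (x : Tˣ) (σ : K⟦X⟧) : T⟦X⟧ :=
  PowerSeries.C (x : T) *
    PowerSeries.rescale ((x⁻¹ : Tˣ) : T) (PowerSeries.map (algebraMap K T) σ)

/-! ### Analytic independence

`R[[z]][[y_i : i ∈ ι]] = R[[z, y_i : i ∈ ι]]` is `MvPowerSeries (Option ι) R`, where `none` is the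
index of the variable `z` and `some i` is the index of `y_i`. -/

/-- The images of the variables: `z ↦ z`, `y_i ↦ lam i`. -/
def analyticPoint {ι T : Type*} [CommRing T] (lam : ι → T⟦X⟧) : Option ι → T⟦X⟧
  | none => PowerSeries.X
  | some i => lam i

theorem hasSubst_analyticPoint {ι T : Type*} [Finite ι] [CommRing T] (lam : ι → T⟦X⟧)
    (h : ∀ i, PowerSeries.constantCoeff (lam i) = 0) :
    MvPowerSeries.HasSubst (analyticPoint lam) := by
  apply MvPowerSeries.hasSubst_of_constantCoeff_zero
  rintro (_ | i)
  · exact PowerSeries.constantCoeff_X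
  · exact h i

/-- The homomorphism `θ : R[[z]][[y_i : i ∈ ι]] → T[[z]]` over `R[[z]]` with `θ(y_i) = lam i`, for
`lam i ∈ z T[[z]]`. -/
def analyticHom (R : Type*) {ι T : Type*} [Finite ι] [CommRing R] [CommRing T] [Algebra R T]
    (lam : ι → T⟦X⟧) (h : ∀ i, PowerSeries.constantCoeff (lam i) = 0) :
    MvPowerSeries (Option ι) R →ₐ[R] T⟦X⟧ :=
  MvPowerSeries.substAlgHom (hasSubst_analyticPoint lam h)

/-- Elements `lam i` of `z T[[z]]` are analytically independent over `R[[z]]`. -/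
def AnalyticallyIndependent (R : Type*) {ι T : Type*} [Finite ι] [CommRing R] [CommRing T]
    [Algebra R T] (lam : ι → T⟦X⟧) : Prop :=
  ∃ h : ∀ i, PowerSeries.constantCoeff (lam i) = 0, Function.Injective (analyticHom R lam h)

/-! ### The rings of the extension

`K[x, y_1, …, y_n]` is `MvPolynomial (Option (Fin n)) K`, where `none` is the index of `x` and
`some i` is the index of `y_{i+1}`. -/

section Rings

variable (K : Type*) [Field K] (n : ℕ)

/-- `K[x, y_1, …, y_n]`. -/
abbrev PolyRing : Type _ := MvPolynomial (Option (Fin n)) K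

/-- `K[x, y_1, …, y_n]_x`. -/
abbrev PolyRingAway : Type _ := Localization.Away (MvPolynomial.X none : PolyRing K n)

/-- The extension `K[x, y_1, …, y_n][[z]] → K[x, y_1, …, y_n]_x[[z]]`. -/
def extension : (PolyRing K n)⟦X⟧ →+* (PolyRingAway K n)⟦X⟧ :=
  PowerSeries.map (algebraMap (PolyRing K n) (PolyRingAway K n))

/-- The unit `x` of `K[x, y_1, …, y_n]_x`. -/
def xAway : (PolyRingAway K n)ˣ :=
  (IsLocalization.Away.algebraMap_isUnit (S := PolyRingAway K n)
    (MvPolynomial.X none : PolyRing K n)).unit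

/-- The unit `x` of `K((x))`. -/
def xLaurent : (K⸨X⸩)ˣ :=
  Units.mk0 (HahnSeries.single 1 1) (HahnSeries.single_ne_zero one_ne_zero)

/-- The inclusion `K[x, y_1, …, y_n] → K((x))[[y_1, …, y_n]]`. -/
def polyToSeries : PolyRing K n →ₐ[K] MvPowerSeries (Fin n) K⸨X⸩ :=
  MvPolynomial.aeval fun o => o.elim (MvPowerSeries.C (xLaurent K : K⸨X⸩)) MvPowerSeries.X

theorem isUnit_polyToSeries_x :
    IsUnit ((polyToSeries K n).toRingHom (MvPolynomial.X none : PolyRing K n)) := by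
  have h : (polyToSeries K n).toRingHom (MvPolynomial.X none : PolyRing K n) =
      MvPowerSeries.C (xLaurent K : K⸨X⸩) := by
    simp [polyToSeries]
  rw [h]
  exact (xLaurent K).isUnit.map _

/-- The inclusion `K[x, y_1, …, y_n]_x → K((x))[[y_1, …, y_n]]`. -/
def awayToSeries : PolyRingAway K n →+* MvPowerSeries (Fin n) K⸨X⸩ :=
  IsLocalization.Away.lift (MvPolynomial.X none : PolyRing K n) (isUnit_polyToSeries_x K n)

/-- `K((x))[[z, y_1, …, y_n]]`, where `none` is the index of `z` and `some i` that of `y_{i+1}`. -/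
abbrev BigRing : Type _ := MvPowerSeries (Option (Fin n)) K⸨X⸩

/-- The inclusion `K[x, y_1, …, y_n]_x[[z]] → K((x))[[y_1, …, y_n]][[z]] = K((x))[[z, y_1, …, y_n]]`.
-/
def awayToBig : (PolyRingAway K n)⟦X⟧ →+* BigRing K n :=
  ((MvPowerSeries.optionEquivLeft (Fin n) K⸨X⸩).symm : _ →+* BigRing K n).comp
    (PowerSeries.map (awayToSeries K n))

/-- The inclusion `K[[x, z, y_1, …, y_n]] = K[[x]][[z, y_1, …, y_n]] → K((x))[[z, y_1, …, y_n]]`. -/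
def integralToBig : MvPowerSeries (Option (Fin n)) K⟦X⟧ →+* BigRing K n :=
  MvPowerSeries.map (algebraMap K⟦X⟧ K⸨X⸩)

end Rings

/-! ### The chain of primes -/

section Chain

variable {K : Type*} [Field K] {n : ℕ}

/-- The images of the variables in `K((x))[[z, y_{j+1}, …, y_n]]`: `z ↦ z`, `y_i ↦ lam i` for
`i ≤ j`, and `y_i ↦ y_i` for `i > j` (indices are shifted by one, as `Fin n` starts at `0`). -/
def chainPoint (lam : Fin n → K⸨X⸩⟦X⟧) (j : ℕ) :
    Option (Fin n) → MvPowerSeries (Option {i : Fin n // j ≤ (i : ℕ)}) K⸨X⸩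
  | none => MvPowerSeries.X none
  | some i => if h : j ≤ (i : ℕ) then MvPowerSeries.X (some ⟨i, h⟩)
      else (lam i).toMvPowerSeries none

theorem hasSubst_chainPoint (lam : Fin n → K⸨X⸩⟦X⟧)
    (h : ∀ i, PowerSeries.constantCoeff (lam i) = 0) (j : ℕ) :
    MvPowerSeries.HasSubst (chainPoint lam j) := by
  apply MvPowerSeries.hasSubst_of_constantCoeff_zero
  rintro (_ | i)
  · exact MvPowerSeries.constantCoeff_X _
  · by_cases hi : j ≤ (i : ℕ)
    · simp [chainPoint, hi]
    · simp only [chainPoint, hi, dite_false]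
      rw [← MvPowerSeries.coeff_zero_eq_constantCoeff_apply]
      exact PowerSeries.toMvPowerSeries_coeff_eq_zero (by simp) (h i)

/-- The homomorphism `θ_j : K((x))[[z, y_1, …, y_n]] → K((x))[[z, y_{j+1}, …, y_n]]` over
`K((x))[[z]]` with `y_i ↦ lam i` for `i ≤ j` and `y_i ↦ y_i` for `i > j`. -/
def chainHom (lam : Fin n → K⸨X⸩⟦X⟧) (h : ∀ i, PowerSeries.constantCoeff (lam i) = 0) (j : ℕ) :
    BigRing K n →ₐ[K⸨X⸩] MvPowerSeries (Option {i : Fin n // j ≤ (i : ℕ)}) K⸨X⸩ :=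
  MvPowerSeries.substAlgHom (hasSubst_chainPoint lam h j)

theorem constantCoeff_twist {T : Type*} [CommRing T] [Algebra K T] (x : Tˣ) (σ : Fin n → K⟦X⟧)
    (h : ∀ i, PowerSeries.constantCoeff (σ i) = 0) (i : Fin n) :
    PowerSeries.constantCoeff (twist x (σ i)) = 0 := by
  have hi : PowerSeries.coeff 0 (σ i) = 0 := by simpa using h i
  rw [← PowerSeries.coeff_zero_eq_constantCoeff_apply, twist, PowerSeries.coeff_C_mul,
    PowerSeries.coeff_rescale, PowerSeries.coeff_map, hi]
  simp

/-- The ideal `P_j = ker θ_j` of `K((x))[[z, y_1, …, y_n]]` for the series `x σ_i(z/x)`. -/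
def chainP (σ : Fin n → K⟦X⟧) (h : ∀ i, PowerSeries.constantCoeff (σ i) = 0) (j : ℕ) :
    Ideal (BigRing K n) :=
  RingHom.ker
    (chainHom (fun i => twist (xLaurent K) (σ i)) (constantCoeff_twist (xLaurent K) σ h) j)

/-- The ideal `Q_j = P_j ∩ K[x, y_1, …, y_n]_x[[z]]`. -/
def chainQ (σ : Fin n → K⟦X⟧) (h : ∀ i, PowerSeries.constantCoeff (σ i) = 0) (j : ℕ) :
    Ideal (PolyRingAway K n)⟦X⟧ :=
  (chainP σ h j).comap (awayToBig K n)

/-- The element `y_{i+1} - x σ_{i+1}(z/x)` of `K((x))[[z, y_1, …, y_n]]`. -/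
def diffBig (σ : Fin n → K⟦X⟧) (i : Fin n) : BigRing K n :=
  MvPowerSeries.X (some i) - (twist (xLaurent K) (σ i)).toMvPowerSeries none

/-- The element `y_{i+1} - x σ_{i+1}(z/x)` of `K[x, y_1, …, y_n]_x[[z]]`. -/
def diffAway (σ : Fin n → K⟦X⟧) (i : Fin n) : (PolyRingAway K n)⟦X⟧ :=
  PowerSeries.C (algebraMap (PolyRing K n) (PolyRingAway K n) (MvPolynomial.X (some i))) -
    twist (xAway K n) (σ i)

end Chain

open scoped RatFunc in
/-- The series `σ_i ∈ F[[z]]` are algebraically independent over `F(z)`, inside `F((z))`. -/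
def AlgIndepOverRatFunc {F ι : Type*} [Field F] (σ : ι → F⟦X⟧) : Prop :=
  AlgebraicIndependent (RatFunc F) fun i => algebraMap F⟦X⟧ F⸨X⸩ (σ i)

/-- The inclusion `Ω[[z]] → K[[z]]`, where `Ω` is the prime subfield of `K`. -/
def primeToSeries (K : Type*) [Field K] : (⊥ : Subfield K)⟦X⟧ →+* K⟦X⟧ :=
  PowerSeries.map (⊥ : Subfield K).subtype

end GenericFiber

end

/-! ### Algebraic independence of power series over rational functions -/

namespace GenericFiber

/-! The point is the homogeneity of `λ_i = x σ_i(z/x)`. Since also `z = x · (z/x)`, a monomial `d`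
of total degree `|d|` in `z, λ_1, …, λ_n` equals `x^|d|` times the same monomial in `z, σ_1, …,
σ_n`, rescaled by `z ↦ z/x` (`coeff_prod_analyticPoint_twist`). So for `F = ∑ f_{d,k} x^k (z,y)^d`
over `K[[x]]`, the coefficient of `x^(N-m) z^m` in `F(z, λ)` is the `z^m`-coefficient of `P_N(z,
σ)`, where the polynomial `P_N` has coefficients `f_{d,N-|d|}` for `|d| ≤ N`. If `F(z, λ) = 0`,
every `P_N` vanishes by algebraic independence, hence `F = 0` (`analyticallyIndependent_twist`).

Each `θ_j` is the automorphism `y_i ↦ y_i + λ_i` (`i ≤ j`) followed by setting `y_1, …, y_j` to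
zero, which gives the generators of `P_j` (`ker_chainHom`). Analytic independence says that `P_n`
meets `K[[x, z, y]]` in zero. Contracting the `P_j` to `K[x, y]_x[[z]]` keeps the inclusions strict,
because the elements `y_j - λ_j` already lie there, having only powers of `x` in their denominators.

Suitable `σ_i` exist over the countable prime field by cardinality, and their independence survives
extension of the field (`algebraicIndependent_map`). -/

open scoped RatFunc in
/-- Algebraic independence over `F(z)` of power series amounts to algebraic independence over `F`
of these series together with `z`. -/
theorem algIndepOverRatFunc_iff {F ι : Type*} [Field F] (σ : ι → F⟦X⟧) :
    AlgIndepOverRatFunc σ ↔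
      AlgebraicIndependent F (fun o : Option ι => o.elim (PowerSeries.X : F⟦X⟧) σ) := by
  have h1 : AlgIndepOverRatFunc σ ↔
      AlgebraicIndependent (Polynomial F) (fun i => algebraMap F⟦X⟧ F⸨X⸩ (σ i)) := by
    -- Clearing denominators: independence over `F(z)` is independence over `F[z]`.
    have : Algebra.IsAlgebraic (Polynomial F) (RatFunc F) :=
      IsLocalization.isAlgebraic _ (nonZeroDivisors (Polynomial F))
    exact (Algebra.IsAlgebraic.algebraicIndependent_iff (Polynomial F) _).symm
  have : IsScalarTower (Polynomial F) F⟦X⟧ F⸨X⸩ := .of_algebraMap_eq fun _ => rfl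
  have h2 : AlgebraicIndependent (Polynomial F) (fun i => algebraMap F⟦X⟧ F⸨X⸩ (σ i)) ↔
      AlgebraicIndependent (Polynomial F) σ :=
    AlgHom.algebraicIndependent_iff (IsScalarTower.toAlgHom (Polynomial F) F⟦X⟧ F⸨X⸩)
      (IsFractionRing.injective F⟦X⟧ F⸨X⸩)
  have h3 : (MvPolynomial.aeval fun o : Option ι => o.elim (PowerSeries.X : F⟦X⟧) σ) =
      ((MvPolynomial.aeval σ : MvPolynomial ι (Polynomial F) →ₐ[Polynomial F] F⟦X⟧).restrictScalars
        F).comp (MvPolynomial.optionEquivRight F ι).toAlgHom := by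
    ext o : 1
    rcases o with _ | i <;> simp [PowerSeries.algebraMap_apply']
  rw [h1, h2, AlgebraicIndependent, AlgebraicIndependent, h3]
  simp

/-- Algebraic independence of power series is preserved by extension of the coefficient field. -/
theorem algebraicIndependent_map {Ω K ι : Type*} [Field Ω] [Field K] [Algebra Ω K]
    {g : ι → Ω⟦X⟧} (hg : AlgebraicIndependent Ω g) :
    AlgebraicIndependent K fun i => PowerSeries.map (algebraMap Ω K) (g i) := by
  rw [algebraicIndependent_iff] at hg ⊢
  intro p hp
  ext d
  -- An `Ω`-linear functional on `K`, applied to the coefficients of a relation over `K`, yields a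
  -- relation over `Ω`, because the series have coefficients in `Ω`. Functionals separate the points
  -- of `K`.
  rw [MvPolynomial.coeff_zero, ← Module.forall_dual_apply_eq_zero_iff Ω]
  intro φ
  have hq := hg (∑ e ∈ p.support, MvPolynomial.monomial e (φ (p.coeff e))) <| by
    ext m
    have h := congrArg (fun f => φ (PowerSeries.coeff m f)) hp
    simp only [MvPolynomial.aeval_def, MvPolynomial.eval₂_eq, map_sum, map_zero,
      PowerSeries.algebraMap_apply, PowerSeries.coeff_C_mul, Algebra.algebraMap_self_apply] at h
    simp only [map_sum, MvPolynomial.aeval_monomial, PowerSeries.algebraMap_apply,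
      PowerSeries.coeff_C_mul, Algebra.algebraMap_self_apply, map_zero, Finsupp.prod]
    rw [← h]
    refine Finset.sum_congr rfl fun e _ => ?_
    rw [← Finset.prod_congr rfl fun i _ => map_pow (PowerSeries.map (algebraMap Ω K)) (g i) (e i),
      ← map_prod, PowerSeries.coeff_map, mul_comm (p.coeff e), ← Algebra.smul_def, map_smul,
      smul_eq_mul, mul_comm]
  have hd := congrArg (MvPolynomial.coeff d) hq
  classical
  simp only [MvPolynomial.coeff_sum, MvPolynomial.coeff_monomial, MvPolynomial.coeff_zero,
    Finset.sum_ite_eq'] at hd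
  by_cases h : d ∈ p.support
  · simpa [h] using hd
  · rw [MvPolynomial.notMem_support_iff.1 h, map_zero]

theorem AlgIndepOverRatFunc.map {Ω K ι : Type*} [Field Ω] [Field K] [Algebra Ω K]
    {τ : ι → Ω⟦X⟧} (h : AlgIndepOverRatFunc τ) :
    AlgIndepOverRatFunc fun i => PowerSeries.map (algebraMap Ω K) (τ i) := by
  rw [algIndepOverRatFunc_iff] at h ⊢
  convert algebraicIndependent_map (K := K) h using 2 with o
  rcases o with _ | i <;> simp

theorem countable_bot_subfield (K : Type*) [Field K] : Countable (⊥ : Subfield K) := by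
  rw [← Cardinal.mk_le_aleph0_iff, ← Subfield.closure_empty]
  exact (Subfield.cardinalMk_closure_le_max ∅).trans (by simp)

/-- For countable `F` the ring `F[[z]]` is uncountable, so its transcendence bases over `F` are
infinite. As `zF[[z]]` generates `F[[z]]` as an algebra, some basis contains `z` and lies in
`zF[[z]]`; any `n` of its members other than `z` will do. -/
theorem exists_algIndepOverRatFunc {F : Type*} [Field F] [Countable F] (n : ℕ) :
    ∃ τ : Fin n → F⟦X⟧, (∀ i, PowerSeries.constantCoeff (τ i) = 0) ∧ AlgIndepOverRatFunc τ := by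
  let t : Set F⟦X⟧ := {f | PowerSeries.constantCoeff f = 0}
  have ht : Algebra.adjoin F t = ⊤ := by
    refine eq_top_iff.2 fun f _ => ?_
    have : f = (f - PowerSeries.C (PowerSeries.constantCoeff f)) +
      algebraMap F F⟦X⟧ (PowerSeries.constantCoeff f) := by
        simp
    rw [this]
    exact add_mem (Algebra.subset_adjoin (by simp [t])) (Subalgebra.algebraMap_mem _ _)
  have : Algebra.IsAlgebraic (Algebra.adjoin F t) F⟦X⟧ := by
    rw [ht]
    exact ⟨fun x => isAlgebraic_algebraMap (⟨x, trivial⟩ : (⊤ : Subalgebra F F⟦X⟧))⟩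
  have hX : AlgebraicIndepOn F id ({PowerSeries.X} : Set F⟦X⟧) := by
    refine algebraicIndependent_unique_type_iff.2 ?_
    rw [transcendental_iff_injective]
    intro p q h
    exact Polynomial.coe_injective F
      (by simpa [Polynomial.aeval_def, Polynomial.eval₂_C_X_eq_coe] using h)
  obtain ⟨u, hXu, hut, hu⟩ := exists_isTranscendenceBasis_between (R := F)
    {(PowerSeries.X : F⟦X⟧)} t (by simp [t]) hX
  have huinf : u.Infinite := by
    intro hfin
    have : Countable u := hfin.countable
    have : Nonempty u := ⟨⟨_, hXu rfl⟩⟩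
    have hcard := hu.lift_cardinalMk_eq_max_lift
    have : Countable F⟦X⟧ := by
      rw [← Cardinal.mk_le_aleph0_iff, ← Cardinal.lift_le_aleph0, hcard]
      simp
    -- The series with coefficients 0 and 1 are already uncountably many.
    have hinj : Function.Injective fun s : Set ℕ =>
        (PowerSeries.mk fun m => open scoped Classical in if m ∈ s then (1 : F) else 0) := by
      intro s s' h
      ext m
      have := congrArg (PowerSeries.coeff m) h
      simp only [PowerSeries.coeff_mk] at this
      split_ifs at this <;> simp_all
    have hle : Cardinal.mk (Set ℕ) ≤ Cardinal.aleph0 := Cardinal.mk_le_aleph0_iff.2 hinj.countable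
    rw [Cardinal.mk_set, Cardinal.mk_nat] at hle
    exact (Cardinal.cantor _).not_ge hle
  have : Infinite (u \ {PowerSeries.X} : Set F⟦X⟧) :=
    (huinf.sdiff (Set.finite_singleton _)).to_subtype
  obtain ⟨e⟩ : Nonempty (Fin n ↪ (u \ {PowerSeries.X} : Set F⟦X⟧)) :=
    ⟨Fin.valEmbedding.trans (Infinite.natEmbedding _)⟩
  refine ⟨fun i => (e i : F⟦X⟧), fun i => hut (e i).2.1, ?_⟩
  rw [algIndepOverRatFunc_iff]
  let c : Option (Fin n) → u := fun o => o.elim ⟨PowerSeries.X, hXu rfl⟩ fun i => ⟨e i, (e i).2.1⟩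
  have hc : Function.Injective c := by
    rintro (_ | i) (_ | k) h
    · rfl
    · exact absurd (congrArg Subtype.val h).symm (e k).2.2
    · exact absurd (congrArg Subtype.val h) (e i).2.2
    · simpa [c, Subtype.ext_iff, ← Subtype.ext_iff] using h
  convert hu.1.comp c hc using 1
  ext1 o
  rcases o with _ | i <;> rfl

end GenericFiber

/-! ### Analytic independence of the twisted series -/

namespace GenericFiber

variable {K : Type*} [Field K] {n : ℕ}

theorem coeff_algebraMap_powerSeries (f : K⟦X⟧) (N d : ℕ) :
    (algebraMap K⟦X⟧ K⸨X⸩ f).coeff ((N : ℤ) - d) =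
      if d ≤ N then PowerSeries.coeff (N - d) f else 0 := by
  change (f : K⸨X⸩).coeff _ = _
  rw [PowerSeries.coeff_coe]
  split_ifs with h1 h2 h2
  · omega
  · rfl
  · congr 2
    omega
  · omega

/-- The powers of the variables `z` and `y_i`, evaluated at `z` and `x σ_i(z/x)`. -/
theorem coeff_prod_analyticPoint_twist (σ : Fin n → K⟦X⟧) (d : Option (Fin n) →₀ ℕ) (m : ℕ) :
    PowerSeries.coeff m
      (d.prod fun s e => analyticPoint (fun i => twist (xLaurent K) (σ i)) s ^ e) =
    HahnSeries.single ((d.degree : ℤ) - m) (PowerSeries.coeff m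
      (d.prod fun s e => (s.elim (PowerSeries.X : K⟦X⟧) σ) ^ e)) := by
  have hpoint : ∀ s, analyticPoint (fun i => twist (xLaurent K) (σ i)) s =
      PowerSeries.C (xLaurent K : K⸨X⸩) * PowerSeries.rescale (((xLaurent K)⁻¹ : (K⸨X⸩)ˣ) : K⸨X⸩)
        (PowerSeries.map (algebraMap K K⸨X⸩) (s.elim (PowerSeries.X : K⟦X⟧) σ)) := by
    rintro (_ | i)
    · simp [analyticPoint, PowerSeries.rescale_X, ← mul_assoc, ← map_mul]
    · rfl
  have hx : ∀ k : ℕ, (xLaurent K : K⸨X⸩) ^ k = HahnSeries.single (k : ℤ) 1 := by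
    intro k
    simp [xLaurent, HahnSeries.single_pow]
  have hxinv : ∀ k : ℕ, (((xLaurent K)⁻¹ : (K⸨X⸩)ˣ) : K⸨X⸩) ^ k =
      HahnSeries.single (-(k : ℤ)) 1 := by
    intro k
    rw [← Units.val_pow_eq_pow_val, inv_pow, Units.val_inv_eq_inv_val, Units.val_pow_eq_pow_val, hx,
      HahnSeries.inv_single, inv_one]
  simp only [hpoint, Finsupp.prod, mul_pow, Finset.prod_mul_distrib, Finset.prod_pow_eq_pow_sum]
  simp only [← map_pow, ← map_prod]
  rw [PowerSeries.coeff_C_mul, PowerSeries.coeff_rescale, PowerSeries.coeff_map, hxinv]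
  rw [hx, LaurentSeries.algebraMap_apply, HahnSeries.C_apply, HahnSeries.single_mul_single,
    HahnSeries.single_mul_single]
  simp [Finsupp.degree_apply, sub_eq_add_neg]

theorem analyticallyIndependent_twist (σ : Fin n → K⟦X⟧)
    (h : ∀ i, PowerSeries.constantCoeff (σ i) = 0) (hσ : AlgIndepOverRatFunc σ) :
    AnalyticallyIndependent K⟦X⟧ fun i => twist (xLaurent K) (σ i) := by
  rw [algIndepOverRatFunc_iff, algebraicIndependent_iff] at hσ
  refine ⟨constantCoeff_twist (xLaurent K) σ h, ?_⟩
  rw [injective_iff_map_eq_zero]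
  intro F hF
  have hsub := hasSubst_analyticPoint _ (constantCoeff_twist (xLaurent K) σ h)
  have hfin := Finsupp.finite_of_degree_le (σ := Option (Fin n))
  -- `P N` collects the terms of `F` of total degree `N` in `x`, `z` and the `y_i`, with `x` set to
  -- 1. There are finitely many, so it is a polynomial.
  let P : ℕ → MvPolynomial (Option (Fin n)) K := fun N =>
    ∑ d ∈ (hfin N).toFinset,
      MvPolynomial.monomial d (PowerSeries.coeff (N - d.degree) (MvPowerSeries.coeff d F))
  have hP : ∀ N, P N = 0 := by
    intro N
    refine hσ _ ?_
    ext m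
    have h1 := MvPowerSeries.coeff_subst hsub F (Finsupp.single () m)
    have h2 := MvPowerSeries.coeff_subst_finite hsub F (Finsupp.single () m)
    rw [← MvPowerSeries.coe_substAlgHom hsub] at h1
    rw [show MvPowerSeries.substAlgHom hsub F = 0 from hF, map_zero] at h1
    -- The coefficient of `x^(N-m) z^m` in `F(z, λ)`: it sees exactly the terms of `F` of total
    -- degree `N`.
    have h3 := congrArg (HahnSeries.coeff.addMonoidHom ((N : ℤ) - m)) h1
    rw [map_zero, AddMonoidHom.map_finsum _ h2] at h3
    have h4 : ∀ d : Option (Fin n) →₀ ℕ,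
        HahnSeries.coeff.addMonoidHom ((N : ℤ) - m) (MvPowerSeries.coeff d F •
          MvPowerSeries.coeff (Finsupp.single () m) (d.prod fun s e =>
            analyticPoint (fun i => twist (xLaurent K) (σ i)) s ^ e)) =
        if d.degree ≤ N then PowerSeries.coeff (N - d.degree) (MvPowerSeries.coeff d F) *
          PowerSeries.coeff m (d.prod fun s e => (s.elim (PowerSeries.X : K⟦X⟧) σ) ^ e)
        else 0 := by
      intro d
      have := coeff_prod_analyticPoint_twist σ d m
      rw [PowerSeries.coeff] at this
      rw [this, Algebra.smul_def, HahnSeries.coeff.addMonoidHom_apply, HahnSeries.coeff_mul_single,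
        show (N : ℤ) - m - (d.degree - m) = N - d.degree by ring, coeff_algebraMap_powerSeries,
        ite_mul, zero_mul]
    simp only [h4] at h3
    rw [finsum_eq_sum_of_support_subset (s := (hfin N).toFinset) _ (by
      intro d hd
      simp only [Set.Finite.coe_toFinset, Set.mem_ofPred_eq]
      by_contra hlt
      exact hd (if_neg hlt))] at h3
    rw [map_zero, h3]
    simp only [P, map_sum, MvPolynomial.aeval_monomial, PowerSeries.algebraMap_apply,
      PowerSeries.coeff_C_mul, Algebra.algebraMap_self_apply]
    refine Finset.sum_congr rfl fun d hd => ?_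
    rw [if_pos (by simpa using hd)]
  ext d k
  -- The coefficient of `x^k` in the `d`-th coefficient of `F` occurs in `P N` for `N = k + |d|`.
  have hd := congrArg (MvPolynomial.coeff d) (hP (k + d.degree))
  classical
  simpa [P, MvPolynomial.coeff_sum, MvPolynomial.coeff_monomial] using hd

end GenericFiber

/-! ### Kernels of the substitutions `θ_j` -/

namespace GenericFiber

section Kernel

variable {σ τ R : Type*} [CommRing R]

/-- Puts the killing of variables in the form of a substitution, so that it can be composed with the
shift. -/
theorem killCompl_eq_subst [Finite τ] (e : σ ↪ τ) (f : MvPowerSeries τ R) :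
    MvPowerSeries.killCompl e f =
      f.subst (fun t => MvPowerSeries.killCompl e (MvPowerSeries.X t : MvPowerSeries τ R)) := by
  classical
  have hsub : MvPowerSeries.HasSubst
      (fun t => MvPowerSeries.killCompl e (MvPowerSeries.X t : MvPowerSeries τ R)) := by
    refine MvPowerSeries.hasSubst_of_constantCoeff_zero fun t => ?_
    rw [← MvPowerSeries.coeff_zero_eq_constantCoeff_apply, MvPowerSeries.coeff_killCompl]
    simp
  have hprod : ∀ d : τ →₀ ℕ, (d.prod fun t k =>
      (MvPowerSeries.killCompl e (MvPowerSeries.X t : MvPowerSeries τ R)) ^ k) =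
      MvPowerSeries.killCompl e (MvPowerSeries.monomial d (1 : R)) := by
    intro d
    rw [MvPowerSeries.monomial_one_eq, Finsupp.prod, Finsupp.prod, map_prod]
    simp only [map_pow]
  ext x
  simp only [MvPowerSeries.coeff_subst hsub, hprod, MvPowerSeries.coeff_killCompl]
  rw [finsum_eq_single _ (Finsupp.embDomain e x)]
  · simp
  · intro d hd
    rw [MvPowerSeries.coeff_monomial_ne hd.symm, smul_zero]

/-- A power series without monomials free of the variables in `S` lies in the ideal generated by
these variables. -/
theorem mem_span_X_of_coeff_eq_zero (S : Finset σ) (f : MvPowerSeries σ R)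
    (hf : ∀ d : σ →₀ ℕ, (∀ s ∈ S, d s = 0) → MvPowerSeries.coeff d f = 0) :
    f ∈ Ideal.span ((MvPowerSeries.X : σ → MvPowerSeries σ R) '' S) := by
  classical
  induction S using Finset.induction_on generalizing f with
  | empty =>
    have : f = 0 := by
      ext d
      exact hf d (by simp)
    rw [this]
    exact zero_mem _
  | insert s S _ ih =>
    -- The part of `f` free of the variable `s`; the remainder is divisible by `X s`.
    let g : MvPowerSeries σ R := fun d => if d s = 0 then MvPowerSeries.coeff d f else 0
    have hg : ∀ d, MvPowerSeries.coeff d g = if d s = 0 then MvPowerSeries.coeff d f else 0 :=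
      fun _ => rfl
    have h1 : g ∈ Ideal.span ((MvPowerSeries.X : σ → MvPowerSeries σ R) '' S) := by
      refine ih g fun d hd => ?_
      rw [hg]
      split_ifs with h
      · exact hf d (by simpa [h] using hd)
      · rfl
    have h2 : MvPowerSeries.X s ∣ f - g := by
      rw [MvPowerSeries.X_dvd_iff]
      intro d hd
      simp [hg, hd]
    have h3 : f = (f - g) + g := by ring
    rw [h3]
    refine add_mem (Ideal.mem_of_dvd _ h2 (Ideal.subset_span ⟨s, by simp, rfl⟩))
      (Ideal.span_mono (Set.image_mono (by simp)) h1)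

end Kernel

section Chain

variable {K : Type*} [Field K] {n : ℕ} (lam : Fin n → K⸨X⸩⟦X⟧)

theorem constantCoeff_toMvPowerSeries_eq_zero {R σ : Type*} [CommRing R] [Finite σ] {f : R⟦X⟧}
    (hf : PowerSeries.constantCoeff f = 0) (s : σ) :
    MvPowerSeries.constantCoeff (f.toMvPowerSeries s) = 0 := by
  rw [← MvPowerSeries.coeff_zero_eq_constantCoeff_apply]
  exact PowerSeries.toMvPowerSeries_coeff_eq_zero (by simp) hf

/-- The substitution `y_i ↦ y_i + lam i` for `i ≤ j`, fixing the other variables. -/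
noncomputable def shiftPoint (j : ℕ) : Option (Fin n) → BigRing K n
  | none => MvPowerSeries.X none
  | some i => MvPowerSeries.X (some i) + if j ≤ (i : ℕ) then 0 else (lam i).toMvPowerSeries none

variable {lam} (h : ∀ i, PowerSeries.constantCoeff (lam i) = 0) (j : ℕ)

include h in
theorem hasSubst_shiftPoint : MvPowerSeries.HasSubst (shiftPoint lam j) := by
  refine MvPowerSeries.hasSubst_of_constantCoeff_zero ?_
  rintro (_ | i)
  · exact MvPowerSeries.constantCoeff_X _
  · by_cases hi : j ≤ (i : ℕ)
    · simp [shiftPoint, hi]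
    · simp [shiftPoint, hi, constantCoeff_toMvPowerSeries_eq_zero (h i)]

theorem subst_toMvPowerSeries_none {τ : Type*} {a : Option (Fin n) → MvPowerSeries (Option τ) K⸨X⸩}
    (ha : MvPowerSeries.HasSubst a) (hnone : a none = MvPowerSeries.X none) (f : K⸨X⸩⟦X⟧) :
    MvPowerSeries.subst a (f.toMvPowerSeries none : BigRing K n) = f.toMvPowerSeries none := by
  rw [PowerSeries.subst_toMvPowerSeries ha, hnone, PowerSeries.toMvPowerSeries_eq_subst]

include h in
-- The added series involve only `z`, which both shifts fix, so they cancel.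
theorem subst_neg_shiftPoint_subst_shiftPoint (f : BigRing K n) :
    MvPowerSeries.subst (shiftPoint (-lam) j) (MvPowerSeries.subst (shiftPoint lam j) f) = f := by
  have h' : ∀ i, PowerSeries.constantCoeff ((-lam) i) = 0 := fun i => by simp [h i]
  have hs := hasSubst_shiftPoint h' j
  rw [MvPowerSeries.subst_comp_subst_apply (hasSubst_shiftPoint h j) hs]
  refine Eq.trans ?_ (congrFun (MvPowerSeries.subst_self (σ := Option (Fin n)) (R := K⸨X⸩)) f)
  congr 1
  ext1 s
  rcases s with _ | i
  · exact MvPowerSeries.subst_X hs none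
  · by_cases hi : j ≤ (i : ℕ)
    · simp [shiftPoint, hi, MvPowerSeries.subst_X hs]
    · simp only [shiftPoint, hi, if_false]
      rw [MvPowerSeries.subst_add hs, MvPowerSeries.subst_X hs,
        subst_toMvPowerSeries_none hs rfl]
      simp [shiftPoint, hi]

/-- The inclusion of the variables `z, y_{j+1}, …, y_n` into all variables. -/
def remainingVars (n j : ℕ) : Option {i : Fin n // j ≤ (i : ℕ)} ↪ Option (Fin n) :=
  (Function.Embedding.subtype _).optionMap

/-- Both sides are substitutions, so it suffices to compare the variables: for `i ≤ j`, `y_i` is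
shifted to `y_i + λ_i`, and then `y_i` is killed. -/
theorem chainHom_eq_killCompl (f : BigRing K n) :
    chainHom lam h j f =
      MvPowerSeries.killCompl (remainingVars n j) (MvPowerSeries.subst (shiftPoint lam j) f) := by
  have hsub : MvPowerSeries.HasSubst (fun t => MvPowerSeries.killCompl (remainingVars n j)
      (MvPowerSeries.X t : BigRing K n)) := by
    refine MvPowerSeries.hasSubst_of_constantCoeff_zero fun t => ?_
    rw [← MvPowerSeries.coeff_zero_eq_constantCoeff_apply, MvPowerSeries.coeff_killCompl]
    simp
  have hnone : MvPowerSeries.killCompl (remainingVars n j)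
      (MvPowerSeries.X none : BigRing K n) = MvPowerSeries.X none :=
    MvPowerSeries.killCompl_X none
  rw [killCompl_eq_subst, MvPowerSeries.subst_comp_subst_apply (hasSubst_shiftPoint h j) hsub,
    chainHom, MvPowerSeries.substAlgHom_apply]
  congr 1
  ext1 s
  rcases s with _ | i
  · exact ((MvPowerSeries.subst_X hsub none).trans hnone).symm
  · by_cases hi : j ≤ (i : ℕ)
    · simp only [shiftPoint, hi, if_true, add_zero, chainPoint, dite_true,
        MvPowerSeries.subst_X hsub]
      exact (MvPowerSeries.killCompl_X (e := remainingVars n j) (some ⟨i, hi⟩)).symm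
    · simp only [shiftPoint, hi, if_false, chainPoint, dite_false]
      rw [MvPowerSeries.subst_add hsub, MvPowerSeries.subst_X hsub,
        subst_toMvPowerSeries_none hsub hnone, MvPowerSeries.killCompl_X_eq_zero, zero_add]
      rintro ⟨_ | k, hk⟩
      · simp [remainingVars] at hk
      · simp only [remainingVars, Function.Embedding.optionMap_apply, Option.map_some,
          Option.some.injEq] at hk
        exact hi (hk ▸ k.2)

theorem chainHom_X_sub {i : Fin n} (hi : (i : ℕ) < j) :
    chainHom lam h j (MvPowerSeries.X (some i) - (lam i).toMvPowerSeries none) = 0 := by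
  have hs := hasSubst_chainPoint lam h j
  rw [chainHom, MvPowerSeries.substAlgHom_apply, MvPowerSeries.subst_sub hs,
    MvPowerSeries.subst_X hs, subst_toMvPowerSeries_none hs rfl]
  simp [chainPoint, hi.not_ge]

theorem chainHom_X_sub_ne_zero {i : Fin n} (hi : j ≤ (i : ℕ)) :
    chainHom lam h j (MvPowerSeries.X (some i) - (lam i).toMvPowerSeries none) ≠ 0 := by
  have hs := hasSubst_chainPoint lam h j
  rw [chainHom, MvPowerSeries.substAlgHom_apply, MvPowerSeries.subst_sub hs,
    MvPowerSeries.subst_X hs, subst_toMvPowerSeries_none hs rfl]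
  intro h0
  -- The variable survives under `θ_j` with coefficient 1, while `lam i` has no term in it.
  have := congrArg (MvPowerSeries.coeff (Finsupp.single (some ⟨i, hi⟩) 1)) h0
  rw [map_sub, PowerSeries.toMvPowerSeries_coeff_eq_zero (by simp) (h i)] at this
  simp [chainPoint, hi] at this

/-- After the shift, an element of the kernel has no monomial free of `y_1, …, y_j`, so it lies in
the ideal of these variables. The inverse shift carries `y_i` to `y_i - λ_i`. -/
theorem ker_chainHom :
    RingHom.ker (chainHom lam h j) = Ideal.span
      ((fun i => (MvPowerSeries.X (some i) - (lam i).toMvPowerSeries none : BigRing K n)) ''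
        {i : Fin n | (i : ℕ) < j}) := by
  have h' : ∀ i, PowerSeries.constantCoeff ((-lam) i) = 0 := fun i => by simp [h i]
  have hs := hasSubst_shiftPoint h' j
  refine le_antisymm (fun f hf => ?_) ?_
  · rw [RingHom.mem_ker, chainHom_eq_killCompl] at hf
    let S : Finset (Option (Fin n)) :=
      (Finset.univ.filter fun i : Fin n => (i : ℕ) < j).map Function.Embedding.some
    have hmem := mem_span_X_of_coeff_eq_zero S (MvPowerSeries.subst (shiftPoint lam j) f) (by
      intro d hd
      have hrange : d ∈ Set.range (Finsupp.embDomain (M := ℕ) (remainingVars n j)) := by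
        rw [Finsupp.mem_range_embDomain_iff]
        rintro (_ | i) hi
        · exact ⟨none, rfl⟩
        · refine ⟨some ⟨i, ?_⟩, rfl⟩
          by_contra hlt
          exact (Finsupp.mem_support_iff.1 hi) (hd _ (by simpa [S] using hlt))
      obtain ⟨d', rfl⟩ := hrange
      rw [← MvPowerSeries.coeff_killCompl, hf, map_zero])
    have himage := Ideal.mem_map_of_mem (MvPowerSeries.substAlgHom (R := K⸨X⸩) hs) hmem
    rw [MvPowerSeries.substAlgHom_apply, subst_neg_shiftPoint_subst_shiftPoint h,
      Ideal.map_span] at himage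
    refine Ideal.span_mono ?_ himage
    rintro _ ⟨_, ⟨s, hs', rfl⟩, rfl⟩
    obtain ⟨i, hi, rfl⟩ : ∃ i : Fin n, (i : ℕ) < j ∧ some i = s := by simpa [S] using hs'
    refine ⟨i, hi, ?_⟩
    rw [MvPowerSeries.substAlgHom_X]
    simp [shiftPoint, hi, sub_eq_add_neg]
  · rw [Ideal.span_le]
    rintro _ ⟨i, hi, rfl⟩
    exact chainHom_X_sub h j hi

end Chain

end GenericFiber

/-! ### Embeddings into `K((x))[[z, y_1, …, y_n]]` -/

namespace GenericFiber

section Embedding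

variable (K : Type*) [Field K] (n : ℕ)

/-- The map factors through the injections `K[x][y] → K((x))[y] → K((x))[[y]]`. -/
theorem polyToSeries_injective : Function.Injective (polyToSeries K n) := by
  have halg : algebraMap (Polynomial K) K⸨X⸩ Polynomial.X = (xLaurent K : K⸨X⸩) := by
    change ((Polynomial.X : Polynomial K) : K⟦X⟧) = (_ : K⸨X⸩)
    simp [xLaurent]
  have h : (polyToSeries K n : PolyRing K n →+* MvPowerSeries (Fin n) K⸨X⸩) =
      (MvPolynomial.coeToMvPowerSeries.ringHom.comp
        (MvPolynomial.map (algebraMap (Polynomial K) K⸨X⸩))).comp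
        (MvPolynomial.optionEquivRight K (Fin n) : PolyRing K n →+* _) := by
    refine MvPolynomial.ringHom_ext (fun r => ?_) ?_
    · have hr : algebraMap (Polynomial K) K⸨X⸩ (Polynomial.C r) = algebraMap K K⸨X⸩ r := by
        change ((Polynomial.C r : Polynomial K) : K⟦X⟧) = (_ : K⸨X⸩)
        simp [LaurentSeries.algebraMap_apply]
      rw [← MvPolynomial.algebraMap_eq, RingHom.coe_coe, AlgHom.commutes,
        MvPowerSeries.algebraMap_apply, MvPolynomial.algebraMap_eq]
      simp [hr]
    · rintro (_ | i)
      · simp [polyToSeries, halg]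
      · simp [polyToSeries]
  intro p q hpq
  have hpq' : (polyToSeries K n : PolyRing K n →+* MvPowerSeries (Fin n) K⸨X⸩) p =
      (polyToSeries K n : PolyRing K n →+* MvPowerSeries (Fin n) K⸨X⸩) q := hpq
  rw [h] at hpq'
  exact (MvPolynomial.optionEquivRight K (Fin n)).injective
    (MvPolynomial.map_injective _ (FaithfulSMul.algebraMap_injective _ _)
      (MvPolynomial.coe_injective _ _ hpq'))

theorem algebraMap_polyRing_injective :
    Function.Injective (algebraMap (PolyRing K n) (PolyRingAway K n)) :=
  IsLocalization.injective _ (powers_le_nonZeroDivisors_of_noZeroDivisors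
    (MvPolynomial.X_ne_zero (none : Option (Fin n))))

theorem awayToSeries_algebraMap (p : PolyRing K n) :
    awayToSeries K n (algebraMap _ _ p) = polyToSeries K n p :=
  IsLocalization.Away.lift_eq _ _ _

theorem awayToSeries_injective : Function.Injective (awayToSeries K n) := by
  refine (IsLocalization.lift_injective_iff (S := PolyRingAway K n)
    (M := Submonoid.powers (MvPolynomial.X none : PolyRing K n))
    (g := (polyToSeries K n).toRingHom) _).2 fun p q => ?_
  rw [(algebraMap_polyRing_injective K n).eq_iff]
  exact (polyToSeries_injective K n).eq_iff.symm

theorem powerSeries_map_injective {A B : Type*} [CommRing A] [CommRing B] {f : A →+* B}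
    (hf : Function.Injective f) : Function.Injective (PowerSeries.map f) := by
  intro p q h
  ext m
  exact hf (by simpa using congrArg (PowerSeries.coeff m) h)

theorem extension_injective : Function.Injective (extension K n) :=
  powerSeries_map_injective (algebraMap_polyRing_injective K n)

theorem awayToBig_injective : Function.Injective (awayToBig K n) :=
  (MvPowerSeries.optionEquivLeft (Fin n) K⸨X⸩).symm.injective.comp
    (powerSeries_map_injective (awayToSeries_injective K n))

theorem optionEquivLeft_awayToBig (f : (PolyRingAway K n)⟦X⟧) :
    MvPowerSeries.optionEquivLeft (Fin n) K⸨X⸩ (awayToBig K n f) =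
      PowerSeries.map (awayToSeries K n) f := by
  simp [awayToBig]

theorem coeff_awayToBig (f : (PolyRingAway K n)⟦X⟧) (e : Option (Fin n) →₀ ℕ) :
    MvPowerSeries.coeff e (awayToBig K n f) =
      MvPowerSeries.coeff e.some (awayToSeries K n (PowerSeries.coeff (e none) f)) := by
  have h := MvPowerSeries.coeff_coeff_optionEquivLeft (awayToBig K n f) (e none) e.some
  rw [optionEquivLeft_awayToBig, PowerSeries.coeff_map] at h
  have he : e.some.optionElim (e none) = e := DFunLike.ext _ _ (by rintro (_ | i) <;> simp)
  rw [h, he]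

theorem optionEquivLeft_toMvPowerSeries_none {σ R : Type*} [CommRing R] (f : R⟦X⟧) :
    MvPowerSeries.optionEquivLeft σ R (f.toMvPowerSeries none) =
      PowerSeries.map MvPowerSeries.C f := by
  classical
  ext m x
  rw [MvPowerSeries.coeff_coeff_optionEquivLeft, PowerSeries.coeff_map, MvPowerSeries.coeff_C,
    PowerSeries.toMvPowerSeries_apply]
  split_ifs with hx
  · subst hx
    have h1 := MvPowerSeries.coeff_embDomain_rename (Function.Embedding.punit (none : Option σ)) f
      (Finsupp.single () m)
    rw [Finsupp.embDomain_single] at h1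
    have he : (0 : σ →₀ ℕ).optionElim m = Finsupp.single none m :=
      DFunLike.ext _ _ (by rintro (_ | i) <;> simp)
    rw [he]
    exact h1
  · refine MvPowerSeries.coeff_rename_eq_zero _ _ ?_
    rintro ⟨d, hd⟩
    refine hx (Finsupp.ext fun i => ?_)
    have := DFunLike.congr_fun hd (some i)
    rw [Finsupp.mapDomain_of_notMem_range _ _ (by simp)] at this
    simpa using this.symm

theorem awayToBig_toMvPowerSeries (f : (PolyRingAway K n)⟦X⟧) (g : K⸨X⸩⟦X⟧)
    (h : PowerSeries.map (awayToSeries K n) f = PowerSeries.map MvPowerSeries.C g) :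
    awayToBig K n f = g.toMvPowerSeries none := by
  refine (MvPowerSeries.optionEquivLeft (Fin n) K⸨X⸩).injective ?_
  rw [optionEquivLeft_toMvPowerSeries_none, ← h, optionEquivLeft_awayToBig]

theorem awayToSeries_xAway :
    awayToSeries K n (xAway K n : PolyRingAway K n) = MvPowerSeries.C (xLaurent K : K⸨X⸩) := by
  rw [xAway, IsUnit.unit_spec, awayToSeries_algebraMap]
  simp [polyToSeries]

theorem awayToSeries_xAway_inv :
    awayToSeries K n ((xAway K n)⁻¹ : (PolyRingAway K n)ˣ) =
      MvPowerSeries.C (((xLaurent K)⁻¹ : (K⸨X⸩)ˣ) : K⸨X⸩) := by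
  have h : Units.map (awayToSeries K n : PolyRingAway K n →* _) (xAway K n) =
      Units.map (MvPowerSeries.C : K⸨X⸩ →+* MvPowerSeries (Fin n) K⸨X⸩).toMonoidHom
        (xLaurent K) :=
    Units.ext (awayToSeries_xAway K n)
  exact congrArg Units.val (congrArg (·⁻¹) h)

variable {K n}

theorem awayToBig_twist (s : K⟦X⟧) :
    awayToBig K n (twist (xAway K n) s) = (twist (xLaurent K) s).toMvPowerSeries none := by
  refine awayToBig_toMvPowerSeries K n _ _ ?_
  ext1 m
  rw [PowerSeries.coeff_map, PowerSeries.coeff_map, twist, twist]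
  simp only [PowerSeries.coeff_C_mul, PowerSeries.coeff_rescale, PowerSeries.coeff_map,
    map_mul, map_pow, awayToSeries_xAway, awayToSeries_xAway_inv]
  congr 2
  rw [IsScalarTower.algebraMap_apply K (PolyRing K n) (PolyRingAway K n), awayToSeries_algebraMap,
    AlgHom.commutes, MvPowerSeries.algebraMap_apply]

theorem awayToBig_diffAway (σ : Fin n → K⟦X⟧) (i : Fin n) :
    awayToBig K n (diffAway σ i) = diffBig σ i := by
  rw [diffAway, diffBig, map_sub, awayToBig_twist]
  congr 1
  refine (MvPowerSeries.optionEquivLeft (Fin n) K⸨X⸩).injective ?_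
  rw [optionEquivLeft_awayToBig]
  simp [awayToSeries_algebraMap, polyToSeries]

/-- Without inverting `x`, the coefficients in `K[x, y]` already map to `K[[x]][[y]]`; this lets the
contraction of `P_n` to `K[[x, z, y]]` control the `Q_j`. -/
theorem exists_integralToBig_eq (f : (PolyRing K n)⟦X⟧) :
    ∃ g, integralToBig K n g = awayToBig K n (extension K n f) := by
  let φ : PolyRing K n →ₐ[K] MvPowerSeries (Fin n) K⟦X⟧ :=
    MvPolynomial.aeval fun o => o.elim (MvPowerSeries.C PowerSeries.X) MvPowerSeries.X
  have hφ : ∀ p, MvPowerSeries.map (algebraMap K⟦X⟧ K⸨X⸩) (φ p) = polyToSeries K n p := by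
    intro p
    have : (MvPowerSeries.map (algebraMap K⟦X⟧ K⸨X⸩)).comp (φ : PolyRing K n →+* _) =
        (polyToSeries K n : PolyRing K n →+* MvPowerSeries (Fin n) K⸨X⸩) := by
      refine MvPolynomial.ringHom_ext (fun r => ?_) ?_
      · have hr : algebraMap K⟦X⟧ K⸨X⸩ (algebraMap K K⟦X⟧ r) = algebraMap K K⸨X⸩ r := rfl
        simp only [← MvPolynomial.algebraMap_eq, RingHom.comp_apply, RingHom.coe_coe,
          AlgHom.commutes]
        rw [MvPowerSeries.algebraMap_apply, MvPowerSeries.map_C, hr,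
          MvPowerSeries.algebraMap_apply]
      · rintro (_ | i)
        · simp [φ, polyToSeries, xLaurent]
        · simp [φ, polyToSeries]
    exact congrArg (fun ψ : PolyRing K n →+* MvPowerSeries (Fin n) K⸨X⸩ => ψ p) this
  refine ⟨fun e => MvPowerSeries.coeff e.some (φ (PowerSeries.coeff (e none) f)), ?_⟩
  ext1 e
  rw [coeff_awayToBig, extension, PowerSeries.coeff_map, awayToSeries_algebraMap, ← hφ,
    MvPowerSeries.coeff_map]
  rfl

/-- Reconciles the scalars `K[[x]]` of `analyticHom` with the scalars `K((x))` of `chainHom`. -/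
theorem subst_map {σ τ R S : Type*} [CommRing R] [CommRing S] [Algebra R S]
    {a : σ → MvPowerSeries τ S} (ha : MvPowerSeries.HasSubst a) (f : MvPowerSeries σ R) :
    MvPowerSeries.subst a (MvPowerSeries.map (algebraMap R S) f) = MvPowerSeries.subst a f := by
  ext e
  simp [MvPowerSeries.coeff_subst ha, Algebra.smul_def]

theorem analyticHom_eq_zero_of_chainHom_eq_zero {lam : Fin n → K⸨X⸩⟦X⟧}
    (h : ∀ i, PowerSeries.constantCoeff (lam i) = 0) {f : MvPowerSeries (Option (Fin n)) K⟦X⟧}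
    (hf : chainHom lam h n (integralToBig K n f) = 0) : analyticHom K⟦X⟧ lam h f = 0 := by
  -- For `j = n` no `y_i` remains, so the only index is `none`, and `a` identifies the target of
  -- `θ_n` with `K((x))[[z]]`.
  let a : Option {i : Fin n // n ≤ (i : ℕ)} → K⸨X⸩⟦X⟧ := fun _ => PowerSeries.X
  have ha : MvPowerSeries.HasSubst a :=
    MvPowerSeries.hasSubst_of_constantCoeff_zero fun _ => PowerSeries.constantCoeff_X
  have hs := hasSubst_analyticPoint lam h
  rw [chainHom, MvPowerSeries.substAlgHom_apply] at hf
  have h0 := congrArg (MvPowerSeries.subst a) hf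
  rw [MvPowerSeries.subst_comp_subst_apply (hasSubst_chainPoint lam h n) ha,
    ← MvPowerSeries.substAlgHom_apply (R := K⸨X⸩) ha 0, map_zero] at h0
  rw [analyticHom, MvPowerSeries.substAlgHom_apply, ← subst_map hs, ← h0]
  congr 1
  ext1 s
  rcases s with _ | i
  · exact (MvPowerSeries.subst_X ha none).symm
  · simp only [chainPoint, i.2.not_ge, dite_false, analyticPoint]
    rw [PowerSeries.subst_toMvPowerSeries ha]
    exact (PowerSeries.X_subst (lam i)).symm

end Embedding

end GenericFiber

/-! ### The chain of primes and the generic fiber -/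

namespace GenericFiber

variable {K : Type*} [Field K] {n : ℕ} (σ : Fin n → K⟦X⟧)
  (h : ∀ i, PowerSeries.constantCoeff (σ i) = 0)

theorem chainP_eq_span (j : ℕ) :
    chainP σ h j = Ideal.span (diffBig σ '' {i : Fin n | (i : ℕ) < j}) :=
  ker_chainHom (constantCoeff_twist (xLaurent K) σ h) j

theorem chainP_isPrime (j : ℕ) : (chainP σ h j).IsPrime :=
  have : IsDomain (MvPowerSeries (Option {i : Fin n // j ≤ (i : ℕ)}) K⸨X⸩) :=
    NoZeroDivisors.to_isDomain _
  RingHom.ker_isPrime _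

theorem chainP_zero : chainP σ h 0 = ⊥ := by
  simp [chainP_eq_span]

theorem chainP_mono : Monotone (chainP σ h) := by
  intro j k hjk
  rw [chainP_eq_span, chainP_eq_span]
  exact Ideal.span_mono (Set.image_mono fun i hi => lt_of_lt_of_le hi hjk)

theorem diffBig_mem_chainP (i : Fin n) : diffBig σ i ∈ chainP σ h (i + 1) :=
  chainHom_X_sub (constantCoeff_twist (xLaurent K) σ h) _ (Nat.lt_succ_self _)

theorem diffBig_notMem_chainP (i : Fin n) : diffBig σ i ∉ chainP σ h i :=
  chainHom_X_sub_ne_zero (constantCoeff_twist (xLaurent K) σ h) _ le_rfl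

theorem chainP_comap_integralToBig (hσ : AlgIndepOverRatFunc σ) :
    (chainP σ h n).comap (integralToBig K n) = ⊥ := by
  obtain ⟨h', hinj⟩ := analyticallyIndependent_twist σ h hσ
  rw [eq_bot_iff]
  intro f hf
  exact (injective_iff_map_eq_zero _).1 hinj f (analyticHom_eq_zero_of_chainHom_eq_zero h' hf)

theorem chainQ_zero : chainQ σ h 0 = ⊥ := by
  rw [chainQ, chainP_zero]
  exact (RingHom.injective_iff_ker_eq_bot _).1 (awayToBig_injective K n)

theorem diffAway_mem_chainQ (i : Fin n) : diffAway σ i ∈ chainQ σ h (i + 1) := by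
  rw [chainQ, Ideal.mem_comap, awayToBig_diffAway]
  exact diffBig_mem_chainP σ h i

theorem diffAway_notMem_chainQ (i : Fin n) : diffAway σ i ∉ chainQ σ h i := by
  rw [chainQ, Ideal.mem_comap, awayToBig_diffAway]
  exact diffBig_notMem_chainP σ h i

theorem chainQ_lt (i : Fin n) : chainQ σ h i < chainQ σ h (i + 1) :=
  lt_of_le_of_ne (Ideal.comap_mono (chainP_mono σ h (Nat.le_succ _))) fun heq =>
    diffAway_notMem_chainQ σ h i (heq ▸ diffAway_mem_chainQ σ h i)

/-- An element of the contraction lies in `P_j ⊆ P_n` and comes from `K[[x, z, y]]`, which meets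
`P_n` only in zero. -/
theorem chainQ_comap_extension (hσ : AlgIndepOverRatFunc σ) {j : ℕ} (hj : j ≤ n) :
    (chainQ σ h j).comap (extension K n) = ⊥ := by
  rw [eq_bot_iff]
  intro f hf
  obtain ⟨g, hg⟩ := exists_integralToBig_eq f
  have hmem : g ∈ (chainP σ h n).comap (integralToBig K n) := by
    rw [Ideal.mem_comap, hg]
    exact chainP_mono σ h hj hf
  rw [chainP_comap_integralToBig σ h hσ, Ideal.mem_bot] at hmem
  rw [hmem, map_zero] at hg
  exact extension_injective K n
    (awayToBig_injective K n (by rw [map_zero, map_zero]; exact hg.symm))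

/-- The prime `Q_j`, as a point of the generic fiber. -/
noncomputable def chainPrime (hσ : AlgIndepOverRatFunc σ) (j : Fin (n + 1)) :
    genericFiber (extension K n) :=
  ⟨⟨chainQ σ h j, (chainP_isPrime σ h j).comap _⟩,
    chainQ_comap_extension σ h hσ (Nat.lt_succ_iff.1 j.2)⟩

include h in
theorem le_genericFiberDim (hσ : AlgIndepOverRatFunc σ) :
    (n : WithBot ℕ∞) ≤ genericFiberDim (extension K n) :=
  Order.LTSeries.length_le_krullDim
    { length := n
      toFun := chainPrime σ h hσ
      step := fun i => chainQ_lt σ h i }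

theorem exists_prime_algIndepOverRatFunc (K : Type*) [Field K] (n : ℕ) :
    ∃ τ : Fin n → PowerSeries (⊥ : Subfield K),
      (∀ i, PowerSeries.constantCoeff (τ i) = 0) ∧ AlgIndepOverRatFunc τ ∧
        AlgIndepOverRatFunc fun i => primeToSeries K (τ i) := by
  have := countable_bot_subfield K
  obtain ⟨τ, hτ, hind⟩ := exists_algIndepOverRatFunc (F := (⊥ : Subfield K)) n
  exact ⟨τ, hτ, hind, hind.map (K := K)⟩

theorem constantCoeff_primeToSeries {τ : (⊥ : Subfield K)⟦X⟧}
    (hτ : PowerSeries.constantCoeff τ = 0) :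
    PowerSeries.constantCoeff (primeToSeries K τ) = 0 := by
  rw [← PowerSeries.coeff_zero_eq_constantCoeff_apply] at hτ ⊢
  rw [primeToSeries, PowerSeries.coeff_map, hτ, map_zero]

end GenericFiber

theorem mainTheorem5 {K : Type*} [Field K] (n : ℕ) (hn : 1 ≤ n) :
    -- the generic fiber of the extension has dimension at least `n`
    (Function.Injective (GenericFiber.extension K n) ∧
      (n : WithBot ℕ∞) ≤ GenericFiber.genericFiberDim (GenericFiber.extension K n)) ∧
    -- the chain of primes attached to algebraically independent `σ_1, …, σ_n ∈ z K[[z]]`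
    (∀ (σ : Fin n → PowerSeries K) (h : ∀ i, PowerSeries.constantCoeff (σ i) = 0),
      GenericFiber.AlgIndepOverRatFunc σ →
        GenericFiber.AnalyticallyIndependent (PowerSeries K)
          (fun i => GenericFiber.twist (GenericFiber.xLaurent K) (σ i)) ∧
        GenericFiber.chainP σ h 0 = ⊥ ∧
        (∀ j ≤ n, (GenericFiber.chainP σ h j).IsPrime ∧
          GenericFiber.chainP σ h j =
            Ideal.span (GenericFiber.diffBig σ '' {i : Fin n | (i : ℕ) < j})) ∧
        (∀ i : Fin n,
          GenericFiber.diffBig σ i ∈ GenericFiber.chainP σ h (i + 1) ∧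
          GenericFiber.diffBig σ i ∉ GenericFiber.chainP σ h i) ∧
        (GenericFiber.chainP σ h n).comap (GenericFiber.integralToBig K n) = ⊥ ∧
        GenericFiber.chainQ σ h 0 = ⊥ ∧
        (∀ i : Fin n,
          GenericFiber.chainQ σ h i < GenericFiber.chainQ σ h (i + 1) ∧
          GenericFiber.diffAway σ i ∈ GenericFiber.chainQ σ h (i + 1) ∧
          GenericFiber.diffAway σ i ∉ GenericFiber.chainQ σ h i) ∧
        (∀ j ≤ n, ∃ Q ∈ GenericFiber.genericFiber (GenericFiber.extension K n),
          Q.asIdeal = GenericFiber.chainQ σ h j)) ∧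
    -- independence over the rational functions over the prime subfield `Ω` passes to `K(z)`
    (∀ τ : Fin n → PowerSeries (⊥ : Subfield K),
      (∀ i, PowerSeries.constantCoeff (τ i) = 0) → GenericFiber.AlgIndepOverRatFunc τ →
        GenericFiber.AlgIndepOverRatFunc fun i => GenericFiber.primeToSeries K (τ i)) ∧
    -- the `σ_i` can be chosen in `z Ω[[z]]`
    (∃ τ : Fin n → PowerSeries (⊥ : Subfield K),
      (∀ i, PowerSeries.constantCoeff (τ i) = 0) ∧
        GenericFiber.AlgIndepOverRatFunc τ ∧
        GenericFiber.AlgIndepOverRatFunc fun i => GenericFiber.primeToSeries K (τ i)) := by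
  refine ⟨⟨GenericFiber.extension_injective K n, ?_⟩, fun σ h hσ => ?_,
    fun τ _ hind => hind.map (K := K), GenericFiber.exists_prime_algIndepOverRatFunc K n⟩
  · obtain ⟨τ, hτ, -, hind⟩ := GenericFiber.exists_prime_algIndepOverRatFunc K n
    exact GenericFiber.le_genericFiberDim _
      (fun i => GenericFiber.constantCoeff_primeToSeries (hτ i)) hind
  · exact ⟨GenericFiber.analyticallyIndependent_twist σ h hσ, GenericFiber.chainP_zero σ h,
      fun j _ => ⟨GenericFiber.chainP_isPrime σ h j, GenericFiber.chainP_eq_span σ h j⟩,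
      fun i => ⟨GenericFiber.diffBig_mem_chainP σ h i, GenericFiber.diffBig_notMem_chainP σ h i⟩,
      GenericFiber.chainP_comap_integralToBig σ h hσ, GenericFiber.chainQ_zero σ h,
      fun i => ⟨GenericFiber.chainQ_lt σ h i, GenericFiber.diffAway_mem_chainQ σ h i,
        GenericFiber.diffAway_notMem_chainQ σ h i⟩,
      fun j hj => ⟨GenericFiber.chainPrime σ h hσ ⟨j, Nat.lt_succ_of_le hj⟩,
        (GenericFiber.chainPrime σ h hσ _).2, rfl⟩⟩
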